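/- Let $R$ be a unital commutative ring and let $(\mathcal B,\mathcal L,\theta,\mathcal I)$ be a generalized Boolean dynamical system: $\mathcal B$ is a generalized Boolean algebra (a distributive lattice with relative complements and least element $\emptyset$), $\mathcal L$ is a set, $\theta=(\theta_\alpha)_{\alpha\in\mathcal L}$ is a family of maps $\theta_\alpha:\mathcal B\to\mathcal B$ preserving $\emptyset,\cup,\cap,\setminus$, and $\mathcal I=(\mathcal I_\alpha)_{\alpha\in\mathcal L}$ is a family of ideals of $\mathcal B$ such that $A\in\mathcal I_\alpha$ whenever $A\subseteq\theta_\alpha(C)$ for some $C\in\mathcal B$. For $A\in\mathcal B$ put $\Delta_A=\{\alpha\in\mathcal L:\theta_\alpha(A)\neq\emptyset\}$, and let $\mathcal B_{\mathrm{reg}}$ be the set of $A\in\mathcal B$ such that $0<|\Delta_C|<\infty$ for every $\emptyset\ne C\subseteq A$. Let $L_R(\mathcal B,\mathcal L,\theta,\mathcal I)$ be the universal associative, not necessarily unital, $R$-algebra generated by symbols $p_A$ ($A\in\mathcal B$) and $s_{\alpha,A},s^*_{\alpha,A}$ ($\alpha\in\mathcal L$, $A\in\mathcal I_\alpha$) subject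 to 1. $p_\emptyset=0$, $p_{A\cap A'}=p_Ap_{A'}$, $p_{A\cup A'}=p_A+p_{A'}-p_{A\cap A'}$; 2. $p_As_{\alpha,B}=s_{\alpha,B}p_{\theta_\alpha(A)}$ and $s^*_{\alpha,B}p_A=p_{\theta_\alpha(A)}s^*_{\alpha,B}$; 3. $s^*_{\alpha,B}s_{\alpha',B'}=\delta_{\alpha,\alpha'}p_{B\cap B'}$; 4. $s_{\alpha,B}p_{B'}=s_{\alpha,B\cap B'}$ and $p_{B'}s^*_{\alpha,B}=s^*_{\alpha,B\cap B'}$; 5. $p_A=\sum_{\alpha\in\Delta_A}s_{\alpha,\theta_\alpha(A)}s^*_{\alpha,\theta_\alpha(A)}$ for all $A\in\mathcal B_{\mathrm{reg}}$. Let $(\mathcal B,\mathcal L,\theta,\mathcal B)$ be the generalized Boolean dynamical system with the same $\mathcal B,\mathcal L,\theta$ in which every ideal $\mathcal I_\alpha$ is replaced by $\mathcal B$. Then the $R$-algebras $L_R(\mathcal B,\mathcal L,\theta,\mathcal I)$ and $L_R(\mathcal B,\mathcal L,\theta,\mathcal B)$ are Morita equivalent. Here two not necessarily unital $R$-algebras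 $S,T$ are called Morita equivalent if there is a surjective Morita context between them: an $S$-$T$-bimodule $P$ and a $T$-$S$-bimodule $Q$ ($R$-modules with $R$-bilinear actions, unital in the sense that $SP=P=PT$ and $TQ=Q=QS$), and surjective $R$-linear bimodule maps $(\cdot,\cdot):P\otimes_TQ\to S$ and $[\cdot,\cdot]:Q\otimes_SP\to T$ with $(p,q)p'=p[q,p']$ and $[q,p]q'=q(p,q')$ for all $p,p'\in P$, $q,q'\in Q$. -/

import Mathlib

universe u v w

/-- A generalized Boolean dynamical system `(𝓑, 𝓛, θ, 𝓘)` over a generalized Boolean algebra `B`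
(distributive lattice with least element and relative complements) and a set `L` of letters.
Each `θ α` is a morphism of generalized Boolean algebras, and each `I α` is an ideal of `B`
containing every `A` with `A ≤ θ α C` for some `C`. -/
structure GenBoolDynSys (B : Type v) (L : Type w) [GeneralizedBooleanAlgebra B] where
  /-- the actions of the letters -/
  θ : L → B → B
  θ_bot : ∀ α, θ α ⊥ = ⊥
  θ_sup : ∀ α A C, θ α (A ⊔ C) = θ α A ⊔ θ α C
  θ_inf : ∀ α A C, θ α (A ⊓ C) = θ α A ⊓ θ α C
  θ_sdiff : ∀ α A C, θ α (A \ C) = θ α A \ θ α C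
  /-- the ideals attached to the letters -/
  I : L → Order.Ideal B
  mem_I_of_le : ∀ α A C, A ≤ θ α C → A ∈ I α

namespace GenBoolDynSys

variable {B : Type v} {L : Type w} [GeneralizedBooleanAlgebra B]

/-- The system with the same algebra, letters and actions in which every ideal is all of `B`. -/
def full (D : GenBoolDynSys B L) : GenBoolDynSys B L where
  θ := D.θ
  θ_bot := D.θ_bot
  θ_sup := D.θ_sup
  θ_inf := D.θ_inf
  θ_sdiff := D.θ_sdiff
  I := fun _ => ⊤
  mem_I_of_le := fun _ _ _ _ => trivial

/-- `Δ_A`: the set of letters `α` with `θ_α(A) ≠ ∅`. -/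
def Δ (D : GenBoolDynSys B L) (A : B) : Set L := {α | D.θ α A ≠ ⊥}

/-- The regular sets: those `A` with `0 < |Δ_C| < ∞` for every nonempty `C ⊆ A`. -/
def reg (D : GenBoolDynSys B L) : Set B :=
  {A | ∀ C ≤ A, C ≠ ⊥ → (D.Δ C).Nonempty ∧ (D.Δ C).Finite}

theorem finite_Δ (D : GenBoolDynSys B L) {A : B} (hA : A ∈ D.reg) : (D.Δ A).Finite := by
  by_cases h : A = ⊥
  · have : D.Δ A = ∅ := by
      ext α
      simp [Δ, h, D.θ_bot]
    rw [this]
    exact Set.finite_empty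
  · exact (hA A le_rfl h).2

theorem θ_mem_I (D : GenBoolDynSys B L) (α : L) (A : B) : D.θ α A ∈ D.I α :=
  D.mem_I_of_le α _ A le_rfl

/-- The generating symbols `p_A` (`A ∈ B`), `s_{α,A}` and `s*_{α,A}` (`α ∈ L`, `A ∈ I_α`). -/
inductive Gen (D : GenBoolDynSys B L) : Type (max v w)
  | p (A : B) : Gen D
  | s (α : L) (A : B) (hA : A ∈ D.I α) : Gen D
  | sStar (α : L) (A : B) (hA : A ∈ D.I α) : Gen D

section Algebra

variable (R : Type u) [CommRing R] (D : GenBoolDynSys B L)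

/-- The free (associative, not necessarily unital) `R`-algebra on the generating symbols:
the `R`-algebra of the free semigroup on them. -/
abbrev Free : Type (max u v w) := MonoidAlgebra R (FreeSemigroup D.Gen)

/-- A generating symbol as an element of the free algebra. -/
noncomputable def gen (g : D.Gen) : Free R D := MonoidAlgebra.single (FreeSemigroup.of g) 1

/-- The defining relations. -/
inductive Rel : Free R D → Free R D → Prop
  | p_bot : Rel (gen R D (.p ⊥)) 0
  | p_inf (A C : B) : Rel (gen R D (.p (A ⊓ C))) (gen R D (.p A) * gen R D (.p C))
  | p_sup (A C : B) : Rel (gen R D (.p (A ⊔ C)))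
      (gen R D (.p A) + gen R D (.p C) - gen R D (.p (A ⊓ C)))
  | p_s (A : B) (α : L) (C : B) (hC : C ∈ D.I α) :
      Rel (gen R D (.p A) * gen R D (.s α C hC)) (gen R D (.s α C hC) * gen R D (.p (D.θ α A)))
  | sStar_p (A : B) (α : L) (C : B) (hC : C ∈ D.I α) :
      Rel (gen R D (.sStar α C hC) * gen R D (.p A))
        (gen R D (.p (D.θ α A)) * gen R D (.sStar α C hC))
  | sStar_s (α : L) (A C : B) (hA : A ∈ D.I α) (hC : C ∈ D.I α) :
      Rel (gen R D (.sStar α A hA) * gen R D (.s α C hC)) (gen R D (.p (A ⊓ C)))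
  | sStar_s_ne (α β : L) (hαβ : α ≠ β) (A C : B) (hA : A ∈ D.I α) (hC : C ∈ D.I β) :
      Rel (gen R D (.sStar α A hA) * gen R D (.s β C hC)) 0
  | s_p (α : L) (A C : B) (hA : A ∈ D.I α) :
      Rel (gen R D (.s α A hA) * gen R D (.p C))
        (gen R D (.s α (A ⊓ C) ((D.I α).lower inf_le_left hA)))
  | p_sStar (α : L) (A C : B) (hA : A ∈ D.I α) :
      Rel (gen R D (.p C) * gen R D (.sStar α A hA))
        (gen R D (.sStar α (A ⊓ C) ((D.I α).lower inf_le_left hA)))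
  | p_reg (A : B) (hA : A ∈ D.reg) :
      Rel (gen R D (.p A)) (∑ α ∈ (D.finite_Δ hA).toFinset,
        gen R D (.s α (D.θ α A) (D.θ_mem_I α A)) * gen R D (.sStar α (D.θ α A) (D.θ_mem_I α A)))

/-- The smallest `R`-algebra congruence containing the defining relations. (A ring congruence
that contains all `R`-multiples of the defining relations is stable under `R`-multiples.) -/
noncomputable def con : RingCon (Free R D) :=
  ringConGen fun x y => ∃ (r : R) (a b : Free R D), Rel R D a b ∧ x = r • a ∧ y = r • b

theorem con_smul (r : R) {x y : Free R D} (h : con R D x y) : con R D (r • x) (r • y) := by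
  have h' : RingConGen.Rel (fun x y => ∃ (r : R) (a b : Free R D), Rel R D a b ∧
      x = r • a ∧ y = r • b) x y := h
  clear h
  induction h' with
  | of x y h =>
    obtain ⟨t, a, b, hab, rfl, rfl⟩ := h
    exact RingConGen.Rel.of _ _ ⟨r * t, a, b, hab, smul_smul _ _ _, smul_smul _ _ _⟩
  | refl x => exact (con R D).refl _
  | symm _ ih => exact (con R D).symm ih
  | trans _ _ ih₁ ih₂ => exact (con R D).trans ih₁ ih₂
  | add _ _ ih₁ ih₂ =>
    rw [smul_add, smul_add]
    exact (con R D).add ih₁ ih₂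
  | mul _ h₂ ih₁ _ =>
    rw [← smul_mul_assoc, ← smul_mul_assoc]
    exact (con R D).mul ih₁ h₂

/-- The generalized Boolean dynamical system algebra `L_R(𝓑, 𝓛, θ, 𝓘)`: the universal
(associative, not necessarily unital) `R`-algebra on the generating symbols subject to the
defining relations. -/
def Alg : Type (max u v w) := (con R D).Quotient

noncomputable instance : NonUnitalRing (Alg R D) :=
  inferInstanceAs (NonUnitalRing (con R D).Quotient)

/-- The quotient map from the free algebra. -/
noncomputable def toAlg (x : Free R D) : Alg R D := RingCon.toQuotient (c := con R D) x

theorem toAlg_surjective : Function.Surjective (toAlg R D) := fun x => Quotient.inductionOn' x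
  fun a => ⟨a, rfl⟩

noncomputable instance : SMul R (Alg R D) where
  smul r := Quotient.map' (s₁ := (con R D).toSetoid) (s₂ := (con R D).toSetoid) (fun x => r • x)
    fun _ _ h => con_smul R D r h

/-- The quotient map as an additive homomorphism. -/
noncomputable def toAlgAddHom : Free R D →+ Alg R D where
  toFun := toAlg R D
  map_zero' := rfl
  map_add' _ _ := rfl

noncomputable instance : Module R (Alg R D) :=
  Function.Surjective.module R (toAlgAddHom R D) (toAlg_surjective R D) fun _ _ => rfl

instance : IsScalarTower R (Alg R D) (Alg R D) where
  smul_assoc r x y := by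
    obtain ⟨a, rfl⟩ := toAlg_surjective R D x
    obtain ⟨b, rfl⟩ := toAlg_surjective R D y
    exact congrArg (toAlg R D) (smul_mul_assoc r a b)

instance : SMulCommClass R (Alg R D) (Alg R D) where
  smul_comm r x y := by
    obtain ⟨a, rfl⟩ := toAlg_surjective R D x
    obtain ⟨b, rfl⟩ := toAlg_surjective R D y
    exact congrArg (toAlg R D) (mul_smul_comm r a b).symm

end Algebra

end GenBoolDynSys

section Morita

variable (R : Type u) [CommRing R]

/-- A unital `A`-`C`-bimodule structure on the `R`-module `M`, for not necessarily unital
`R`-algebras `A` and `C`: commuting associative `R`-bilinear actions with `A M = M = M C`. -/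
structure UnitalBimodule (A C M : Type*) [NonUnitalRing A] [Module R A]
    [NonUnitalRing C] [Module R C] [AddCommGroup M] [Module R M] where
  /-- the left action `a m` -/
  left : A →ₗ[R] M →ₗ[R] M
  /-- the right action `m c` -/
  right : M →ₗ[R] C →ₗ[R] M
  left_mul : ∀ a a' m, left (a * a') m = left a (left a' m)
  right_mul : ∀ m c c', right m (c * c') = right (right m c) c'
  left_right : ∀ a m c, left a (right m c) = right (left a m) c
  left_unital : Submodule.span R {x | ∃ a m, left a m = x} = ⊤
  right_unital : Submodule.span R {x | ∃ m c, right m c = x} = ⊤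

/-- A surjective Morita context `(A, C, P, Q, pq, qp)`: unital bimodules `P` and `Q` with
surjective bimodule maps `P ⊗_C Q → A` and `Q ⊗_A P → C` (given as balanced bilinear maps)
satisfying `(p q) p' = p (q p')` and `(q p) q' = q (p q')`. -/
structure SurjectiveMoritaContext (A C P Q : Type*) [NonUnitalRing A] [Module R A]
    [NonUnitalRing C] [Module R C] [AddCommGroup P] [Module R P] [AddCommGroup Q] [Module R Q] where
  bP : UnitalBimodule R A C P
  bQ : UnitalBimodule R C A Q
  /-- the pairing `P ⊗_C Q → A` -/
  pq : P →ₗ[R] Q →ₗ[R] A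
  /-- the pairing `Q ⊗_A P → C` -/
  qp : Q →ₗ[R] P →ₗ[R] C
  pq_balanced : ∀ p c q, pq (bP.right p c) q = pq p (bQ.left c q)
  pq_left : ∀ a p q, pq (bP.left a p) q = a * pq p q
  pq_right : ∀ p q a, pq p (bQ.right q a) = pq p q * a
  qp_balanced : ∀ q a p, qp (bQ.right q a) p = qp q (bP.left a p)
  qp_left : ∀ c q p, qp (bQ.left c q) p = c * qp q p
  qp_right : ∀ q p c, qp q (bP.right p c) = qp q p * c
  assoc_P : ∀ p q p', bP.left (pq p q) p' = bP.right p (qp q p')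
  assoc_Q : ∀ q p q', bQ.left (qp q p) q' = bQ.right q (pq p q')
  pq_surjective : Submodule.span R {a | ∃ p q, pq p q = a} = ⊤
  qp_surjective : Submodule.span R {c | ∃ q p, qp q p = c} = ⊤

/-- Two (not necessarily unital) `R`-algebras are Morita equivalent if they are connected by a
surjective Morita context. -/
def MoritaEquivalent (A : Type v) (C : Type w) [NonUnitalRing A] [Module R A]
    [NonUnitalRing C] [Module R C] : Prop :=
  ∃ (P Q : Type (max v w)) (_ : AddCommGroup P) (_ : Module R P) (_ : AddCommGroup Q)
    (_ : Module R Q), Nonempty (SurjectiveMoritaContext R A C P Q)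

end Morita

/-!
Let `φ : S → T` be the homomorphism between the algebras of `D` and of the full system that maps
each generator to its namesake. The generators `s_{α,C}` of `T` with `C ∉ I_α` are missing from
`S`, but `p_A s_{α,C} = s_{α, C ∩ θ_α(A)}` with `C ∩ θ_α(A) ∈ I_α`; hence `φ(S) T φ(S) ⊆ φ(S)`.
Since `S` and `T` are spanned by elements fixed by one of the idempotents `p_A` or
`s_{α,A} s*_{α,A} = s_{α,A} p_A s*_{α,A}`, also `S S = S` and `T φ(S) T = T`.

For the injectivity of `φ`, note that an element `q` of a `T`-module gives rise to the families
`p_A q` and `s*_{α,A} q`, and that the action of the generators on `q` can be expressed by these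
families and the action of `S` alone. So `T` acts on all families in `S` that behave in this way.
This module contains the families of each `p_C ∈ S`, on which `φ(a)` acts as left multiplication by
`a`, and an element of `S` annihilated by all local units vanishes.

So `S` is isomorphic to a full corner of `T`, and `φ(S) T` and `T φ(S)` form a Morita context.
-/

section RestrictMul

variable {R M N K T : Type*} [CommRing R] [AddCommGroup M] [Module R M] [AddCommGroup N]
  [Module R N] [AddCommGroup K] [Module R K] [NonUnitalRing T] [Module R T]
  [IsScalarTower R T T] [SMulCommClass R T T]

/-- The bilinear map obtained from the multiplication of `T` when its factors lie in the images
of `i` and `j` and its values in that of the injective map `k`. All actions and pairings of the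
Morita context of a full corner are of this form. -/
noncomputable def restrictMul (i : M →ₗ[R] T) (j : N →ₗ[R] T) (k : K →ₗ[R] T)
    (hk : Function.Injective k) (h : ∀ m n, i m * j n ∈ LinearMap.range k) : M →ₗ[R] N →ₗ[R] K :=
  LinearMap.codRestrict₂ ((LinearMap.mul R T).compl₁₂ i j) k hk h

@[simp]
theorem apply_restrictMul (i : M →ₗ[R] T) (j : N →ₗ[R] T) (k : K →ₗ[R] T)
    (hk : Function.Injective k) (h : ∀ m n, i m * j n ∈ LinearMap.range k) (m : M) (n : N) :
    k (restrictMul i j k hk h m n) = i m * j n :=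
  LinearMap.codRestrict₂_apply _ k hk h m n

end RestrictMul

section Span

variable {R M N : Type*} [CommRing R] [AddCommGroup M] [Module R M] [AddCommGroup N] [Module R N]

theorem span_eq_top_of_le_map_subtype {Y : Submodule R M} {X : Set Y}
    (h : Y ≤ (Submodule.span R X).map Y.subtype) : Submodule.span R X = ⊤ :=
  top_le_iff.1 fun y _ => by
    obtain ⟨x, hx, hxy⟩ := h y.2
    rwa [← Y.subtype_injective hxy]

theorem map_mem_of_mem_span {X : Set M} {x : M} (hx : x ∈ Submodule.span R X) (f : M →ₗ[R] N)
    {Y : Submodule R N} (h : ∀ m ∈ X, f m ∈ Y) : f x ∈ Y :=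
  (Submodule.span_le (p := Y.comap f)).2 h hx

theorem map_mem_of_span_eq_top {X : Set M} (hX : Submodule.span R X = ⊤) (f : M →ₗ[R] N)
    {Y : Submodule R N} (h : ∀ m ∈ X, f m ∈ Y) (x : M) : f x ∈ Y :=
  map_mem_of_mem_span (hX ▸ Submodule.mem_top) f h

end Span

section FullCorner

variable {R S T : Type*} [CommRing R] [NonUnitalRing S] [Module R S] [NonUnitalRing T] [Module R T]

/-- The homomorphism `φ` identifies `S` with an idempotent full corner of `T`: it is injective,
`φ(S) T φ(S) ⊆ φ(S)`, `S S = S` and `T φ(S) T = T`. -/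
structure IsFullCorner (φ : S →ₙₐ[R] T) : Prop where
  injective : Function.Injective φ
  mul_mul_mem_range : ∀ a c b, φ a * c * φ b ∈ NonUnitalAlgHom.range φ
  span_mul : Submodule.span R {x | ∃ a b : S, a * b = x} = ⊤
  span_mul_mul : Submodule.span R {x | ∃ c a d, c * φ a * d = x} = ⊤

/-- The right ideal `φ(S) T`. -/
def rangeMul (φ : S →ₙₐ[R] T) : Submodule R T := Submodule.span R {x | ∃ a c, φ a * c = x}

/-- The left ideal `T φ(S)`. -/
def mulRange (φ : S →ₙₐ[R] T) : Submodule R T := Submodule.span R {x | ∃ c a, c * φ a = x}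

variable {φ : S →ₙₐ[R] T}

theorem mul_mem_rangeMul (a : S) (c : T) : φ a * c ∈ rangeMul φ :=
  Submodule.subset_span ⟨a, c, rfl⟩

theorem mul_mem_mulRange (c : T) (a : S) : c * φ a ∈ mulRange φ :=
  Submodule.subset_span ⟨c, a, rfl⟩

theorem rangeMul_mul_mem [IsScalarTower R T T] {x : T} (hx : x ∈ rangeMul φ) (c : T) :
    x * c ∈ rangeMul φ :=
  map_mem_of_mem_span hx (LinearMap.mulRight R c) <| by
    rintro _ ⟨a, d, rfl⟩
    simpa [mul_assoc] using mul_mem_rangeMul a (d * c)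

theorem mul_mulRange_mem [SMulCommClass R T T] (c : T) {x : T} (hx : x ∈ mulRange φ) :
    c * x ∈ mulRange φ :=
  map_mem_of_mem_span hx (LinearMap.mulLeft R c) <| by
    rintro _ ⟨d, a, rfl⟩
    simpa [mul_assoc] using mul_mem_mulRange (c * d) a

namespace IsFullCorner

theorem map_mem_rangeMul (hφ : IsFullCorner φ) (s : S) : φ s ∈ rangeMul φ := by
  refine map_mem_of_span_eq_top hφ.span_mul (φ : S →ₗ[R] T) ?_ s
  rintro _ ⟨a, b, rfl⟩
  simpa using mul_mem_rangeMul a (φ b)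

theorem map_mem_mulRange (hφ : IsFullCorner φ) (s : S) : φ s ∈ mulRange φ := by
  refine map_mem_of_span_eq_top hφ.span_mul (φ : S →ₗ[R] T) ?_ s
  rintro _ ⟨a, b, rfl⟩
  simpa using mul_mem_mulRange (φ a) b

variable [IsScalarTower R T T] [SMulCommClass R T T]

theorem rangeMul_mul_mulRange_mem (hφ : IsFullCorner φ) {x y : T} (hx : x ∈ rangeMul φ)
    (hy : y ∈ mulRange φ) : x * y ∈ LinearMap.range (φ : S →ₗ[R] T) := by
  refine map_mem_of_mem_span hx (LinearMap.mulRight R y) ?_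
  rintro _ ⟨a, c, rfl⟩
  refine map_mem_of_mem_span hy (LinearMap.mulLeft R (φ a * c)) ?_
  rintro _ ⟨d, b, rfl⟩
  simpa [mul_assoc] using hφ.mul_mul_mem_range a (c * d) b

/-- `φ(S) T` as an `S`-`T`-bimodule. -/
noncomputable def rangeMulBimodule (hφ : IsFullCorner φ) :
    UnitalBimodule R S T (rangeMul φ) where
  left := restrictMul (φ : S →ₗ[R] T) (rangeMul φ).subtype (rangeMul φ).subtype
    (rangeMul φ).subtype_injective fun a x => by simpa using mul_mem_rangeMul a x.1
  right := restrictMul (rangeMul φ).subtype LinearMap.id (rangeMul φ).subtype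
    (rangeMul φ).subtype_injective fun x c => by simpa using rangeMul_mul_mem x.2 c
  left_mul _ _ _ := (rangeMul φ).subtype_injective (by simp [-Submodule.subtype_apply, mul_assoc])
  right_mul _ _ _ := (rangeMul φ).subtype_injective (by simp [-Submodule.subtype_apply, mul_assoc])
  left_right _ _ _ := (rangeMul φ).subtype_injective (by simp [-Submodule.subtype_apply, mul_assoc])
  left_unital := span_eq_top_of_le_map_subtype <| Submodule.span_le.2 <| by
    rintro _ ⟨s, c, rfl⟩
    refine map_mem_of_span_eq_top hφ.span_mul (LinearMap.mulRight R c ∘ₗ (φ : S →ₗ[R] T)) ?_ s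
    rintro _ ⟨a, b, rfl⟩
    exact ⟨_, Submodule.subset_span ⟨a, ⟨φ b * c, mul_mem_rangeMul b c⟩, rfl⟩,
      by simp [-Submodule.subtype_apply, mul_assoc]⟩
  right_unital := span_eq_top_of_le_map_subtype <| Submodule.span_le.2 <| by
    rintro _ ⟨a, t, rfl⟩
    refine map_mem_of_span_eq_top hφ.span_mul_mul (LinearMap.mulLeft R (φ a)) ?_ t
    rintro _ ⟨c, b, d, rfl⟩
    exact ⟨_, Submodule.subset_span ⟨⟨φ a * c, mul_mem_rangeMul a c⟩, φ b * d, rfl⟩,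
      by simp [-Submodule.subtype_apply, mul_assoc]⟩

@[simp]
theorem coe_rangeMulBimodule_left (hφ : IsFullCorner φ) (a : S) (x : rangeMul φ) :
    (hφ.rangeMulBimodule.left a x : T) = φ a * x :=
  apply_restrictMul (k := (rangeMul φ).subtype) ..

@[simp]
theorem coe_rangeMulBimodule_right (hφ : IsFullCorner φ) (x : rangeMul φ) (c : T) :
    (hφ.rangeMulBimodule.right x c : T) = x * c :=
  apply_restrictMul (k := (rangeMul φ).subtype) ..

/-- `T φ(S)` as a `T`-`S`-bimodule. -/
noncomputable def mulRangeBimodule (hφ : IsFullCorner φ) :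
    UnitalBimodule R T S (mulRange φ) where
  left := restrictMul LinearMap.id (mulRange φ).subtype (mulRange φ).subtype
    (mulRange φ).subtype_injective fun c x => by simpa using mul_mulRange_mem c x.2
  right := restrictMul (mulRange φ).subtype (φ : S →ₗ[R] T) (mulRange φ).subtype
    (mulRange φ).subtype_injective fun x a => by simpa using mul_mem_mulRange x.1 a
  left_mul _ _ _ := (mulRange φ).subtype_injective (by simp [-Submodule.subtype_apply, mul_assoc])
  right_mul _ _ _ := (mulRange φ).subtype_injective (by simp [-Submodule.subtype_apply, mul_assoc])
  left_right _ _ _ := (mulRange φ).subtype_injective (by simp [-Submodule.subtype_apply, mul_assoc])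
  left_unital := span_eq_top_of_le_map_subtype <| Submodule.span_le.2 <| by
    rintro _ ⟨t, a, rfl⟩
    refine map_mem_of_span_eq_top hφ.span_mul_mul (LinearMap.mulRight R (φ a)) ?_ t
    rintro _ ⟨c, b, d, rfl⟩
    exact ⟨_, Submodule.subset_span ⟨c * φ b, ⟨d * φ a, mul_mem_mulRange d a⟩, rfl⟩,
      by simp [-Submodule.subtype_apply, mul_assoc]⟩
  right_unital := span_eq_top_of_le_map_subtype <| Submodule.span_le.2 <| by
    rintro _ ⟨c, s, rfl⟩
    refine map_mem_of_span_eq_top hφ.span_mul (LinearMap.mulLeft R c ∘ₗ (φ : S →ₗ[R] T)) ?_ s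
    rintro _ ⟨a, b, rfl⟩
    exact ⟨_, Submodule.subset_span ⟨⟨c * φ a, mul_mem_mulRange c a⟩, b, rfl⟩,
      by simp [-Submodule.subtype_apply, mul_assoc]⟩

@[simp]
theorem coe_mulRangeBimodule_left (hφ : IsFullCorner φ) (c : T) (y : mulRange φ) :
    (hφ.mulRangeBimodule.left c y : T) = c * y :=
  apply_restrictMul (k := (mulRange φ).subtype) ..

@[simp]
theorem coe_mulRangeBimodule_right (hφ : IsFullCorner φ) (y : mulRange φ) (a : S) :
    (hφ.mulRangeBimodule.right y a : T) = y * φ a :=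
  apply_restrictMul (k := (mulRange φ).subtype) ..

/-- The pairing `φ(S) T × T φ(S) → S`, which sends `(x, y)` to the preimage of `x y` under `φ`. -/
noncomputable def pairing (hφ : IsFullCorner φ) : rangeMul φ →ₗ[R] mulRange φ →ₗ[R] S :=
  restrictMul (rangeMul φ).subtype (mulRange φ).subtype (φ : S →ₗ[R] T) hφ.injective
    fun x y => hφ.rangeMul_mul_mulRange_mem x.2 y.2

@[simp]
theorem map_pairing (hφ : IsFullCorner φ) (x : rangeMul φ) (y : mulRange φ) :
    φ (hφ.pairing x y) = x * y :=
  apply_restrictMul (k := (φ : S →ₗ[R] T)) ..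

/-- The Morita context between `S` and `T` formed by `φ(S) T`, `T φ(S)` and the multiplication
of `T`. -/
noncomputable def moritaContext (hφ : IsFullCorner φ) :
    SurjectiveMoritaContext R S T (rangeMul φ) (mulRange φ) where
  bP := hφ.rangeMulBimodule
  bQ := hφ.mulRangeBimodule
  pq := hφ.pairing
  qp := (LinearMap.mul R T).compl₁₂ (mulRange φ).subtype (rangeMul φ).subtype
  pq_balanced _ _ _ := hφ.injective (by simp [mul_assoc])
  pq_left _ _ _ := hφ.injective (by simp [mul_assoc])
  pq_right _ _ _ := hφ.injective (by simp [mul_assoc])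
  qp_balanced _ _ _ := by simp [mul_assoc]
  qp_left _ _ _ := by simp [mul_assoc]
  qp_right _ _ _ := by simp [mul_assoc]
  assoc_P _ _ _ := Subtype.ext (by simp [mul_assoc])
  assoc_Q _ _ _ := Subtype.ext (by simp [mul_assoc])
  pq_surjective := by
    refine top_le_iff.1 (hφ.span_mul ▸ Submodule.span_mono ?_)
    rintro _ ⟨a, b, rfl⟩
    exact ⟨⟨φ a, hφ.map_mem_rangeMul a⟩, ⟨φ b, hφ.map_mem_mulRange b⟩, hφ.injective (by simp)⟩
  qp_surjective := by
    refine top_le_iff.1 (hφ.span_mul_mul ▸ Submodule.span_le.2 ?_)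
    rintro _ ⟨c, s, d, rfl⟩
    refine map_mem_of_span_eq_top hφ.span_mul
      (LinearMap.mulRight R d ∘ₗ LinearMap.mulLeft R c ∘ₗ (φ : S →ₗ[R] T)) ?_ s
    rintro _ ⟨a, b, rfl⟩
    exact Submodule.subset_span ⟨⟨c * φ a, mul_mem_mulRange c a⟩, ⟨φ b * d, mul_mem_rangeMul b d⟩,
      by simp [mul_assoc]⟩

end IsFullCorner

end FullCorner

section CommutingEndomorphisms

variable {R M : Type*} [CommRing R] [AddCommGroup M] [Module R M] {E : Set (Module.End R M)}
  {x : M}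

theorem exists_mem_adjoin_apply_eq_self (hE : ∀ e ∈ E, ∀ f ∈ E, e * f = f * e)
    (hx : x ∈ Submodule.span R {y | ∃ e ∈ E, e y = y}) :
    ∃ e ∈ NonUnitalAlgebra.adjoin R E, e x = x := by
  have adjoin_comm {e f : Module.End R M} (he : e ∈ NonUnitalAlgebra.adjoin R E)
      (hf : f ∈ NonUnitalAlgebra.adjoin R E) : e * f = f * e :=
    congrArg Subtype.val <| (NonUnitalAlgebra.isMulCommutative_adjoin R hE).is_comm.comm
      (⟨e, he⟩ : NonUnitalAlgebra.adjoin R E) ⟨f, hf⟩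
  induction hx using Submodule.span_induction with
  | mem y hy =>
    obtain ⟨e, he, hey⟩ := hy
    exact ⟨e, NonUnitalAlgebra.subset_adjoin R he, hey⟩
  | zero => exact ⟨0, zero_mem _, rfl⟩
  | add y z _ _ hy hz =>
    obtain ⟨e, he, hey⟩ := hy
    obtain ⟨f, hf, hfz⟩ := hz
    have hefy : e (f y) = f y := by
      rw [← Module.End.mul_apply, adjoin_comm he hf, Module.End.mul_apply, hey]
    -- `1 - (1 - e) (1 - f)` fixes whatever one of `e` and `f` fixes
    refine ⟨e + f - e * f, sub_mem (add_mem he hf) (mul_mem he hf), ?_⟩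
    simp only [LinearMap.sub_apply, LinearMap.add_apply, Module.End.mul_apply, map_add, hey, hfz,
      hefy]
    abel
  | smul r y _ hy =>
    obtain ⟨e, he, hey⟩ := hy
    exact ⟨e, he, by rw [map_smul, hey]⟩

theorem eq_zero_of_mem_span_fixed (hE : ∀ e ∈ E, ∀ f ∈ E, e * f = f * e)
    (hx : x ∈ Submodule.span R {y | ∃ e ∈ E, e y = y}) (h : ∀ e ∈ E, e x = 0) : x = 0 := by
  obtain ⟨e, he, hex⟩ := exists_mem_adjoin_apply_eq_self hE hx
  suffices e x = 0 from hex.symm.trans this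
  clear hex
  induction he using NonUnitalAlgebra.adjoin_induction with
  | mem e he => exact h e he
  | add e f _ _ he hf => rw [LinearMap.add_apply, he, hf, add_zero]
  | zero => rfl
  | mul e f _ _ _ hf => rw [Module.End.mul_apply, hf, map_zero]
  | smul r e _ he => rw [LinearMap.smul_apply, he, smul_zero]

end CommutingEndomorphisms

namespace GenBoolDynSys

variable {B : Type v} {L : Type w} [GeneralizedBooleanAlgebra B] {D : GenBoolDynSys B L}

theorem inf_mem_I {α : L} {A : B} (hA : A ∈ D.I α) (C : B) : A ⊓ C ∈ D.I α :=
  (D.I α).lower inf_le_left hA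

theorem inf_θ_mem_I (α : L) (A C : B) : A ⊓ D.θ α C ∈ D.I α :=
  D.mem_I_of_le α _ C inf_le_right

theorem mem_full_I (α : L) (A : B) : A ∈ D.full.I α := trivial

/-- A Cuntz-Krieger representation of the system `D` in a not necessarily unital ring: elements
satisfying the relations (1)-(5) that define the algebra of `D`. -/
structure CuntzKriegerRep (D : GenBoolDynSys B L) (S : Type*) [NonUnitalRing S] where
  /-- the elements `p_A` -/
  p : B → S
  /-- the elements `s_{α,A}` -/
  s (α : L) (A : B) (hA : A ∈ D.I α) : S
  /-- the elements `s*_{α,A}` -/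
  sStar (α : L) (A : B) (hA : A ∈ D.I α) : S
  p_bot : p ⊥ = 0
  p_inf (A C : B) : p (A ⊓ C) = p A * p C
  p_sup (A C : B) : p (A ⊔ C) = p A + p C - p (A ⊓ C)
  p_mul_s_eq_s_mul_p (A : B) {α : L} {C : B} (hC : C ∈ D.I α) :
    p A * s α C hC = s α C hC * p (D.θ α A)
  sStar_mul_p_eq_p_mul_sStar (A : B) {α : L} {C : B} (hC : C ∈ D.I α) :
    sStar α C hC * p A = p (D.θ α A) * sStar α C hC
  sStar_mul_s {α : L} {A C : B} (hA : A ∈ D.I α) (hC : C ∈ D.I α) :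
    sStar α A hA * s α C hC = p (A ⊓ C)
  sStar_mul_s_of_ne {α β : L} (h : α ≠ β) {A C : B} (hA : A ∈ D.I α) (hC : C ∈ D.I β) :
    sStar α A hA * s β C hC = 0
  s_mul_p {α : L} {A : B} (hA : A ∈ D.I α) (C : B) :
    s α A hA * p C = s α (A ⊓ C) (inf_mem_I hA C)
  p_mul_sStar {α : L} {A : B} (hA : A ∈ D.I α) (C : B) :
    p C * sStar α A hA = sStar α (A ⊓ C) (inf_mem_I hA C)
  p_eq_sum {A : B} (hA : A ∈ D.reg) :
    p A = ∑ α ∈ (D.finite_Δ hA).toFinset,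
      s α (D.θ α A) (D.θ_mem_I α A) * sStar α (D.θ α A) (D.θ_mem_I α A)

namespace CuntzKriegerRep

variable {S : Type*} [NonUnitalRing S] (ρ : D.CuntzKriegerRep S)

theorem p_mul_p (A C : B) : ρ.p A * ρ.p C = ρ.p (A ⊓ C) := (ρ.p_inf A C).symm

theorem p_mul_p_self (A : B) : ρ.p A * ρ.p A = ρ.p A := by rw [p_mul_p, inf_idem]

theorem p_mul_s {α : L} {A : B} (hA : A ∈ D.I α) (C : B) :
    ρ.p C * ρ.s α A hA = ρ.s α (A ⊓ D.θ α C) (inf_θ_mem_I α A C) :=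
  (ρ.p_mul_s_eq_s_mul_p C hA).trans (ρ.s_mul_p hA _)

theorem sStar_mul_p {α : L} {A : B} (hA : A ∈ D.I α) (C : B) :
    ρ.sStar α A hA * ρ.p C = ρ.sStar α (A ⊓ D.θ α C) (inf_θ_mem_I α A C) :=
  (ρ.sStar_mul_p_eq_p_mul_sStar C hA).trans (ρ.p_mul_sStar hA _)

theorem s_mul_p_self {α : L} {A : B} (hA : A ∈ D.I α) : ρ.s α A hA * ρ.p A = ρ.s α A hA := by
  simp only [s_mul_p, inf_idem]

theorem p_mul_sStar_self {α : L} {A : B} (hA : A ∈ D.I α) :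
    ρ.p A * ρ.sStar α A hA = ρ.sStar α A hA := by
  simp only [p_mul_sStar, inf_idem]

theorem sStar_mul_sStar {α β : L} {A C : B} (hA : A ∈ D.I α) (hC : C ∈ D.I β) :
    ρ.sStar α A hA * ρ.sStar β C hC =
      ρ.sStar α (A ⊓ D.θ α C) (inf_θ_mem_I α A C) * ρ.sStar β C hC := by
  rw [← sStar_mul_p, mul_assoc, p_mul_sStar_self]

/-- A representation of the full system restricts to `D`, which has fewer generators. -/
def restrict (ρ : D.full.CuntzKriegerRep S) : D.CuntzKriegerRep S where
  p := ρ.p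
  s α A _ := ρ.s α A (mem_full_I α A)
  sStar α A _ := ρ.sStar α A (mem_full_I α A)
  p_bot := ρ.p_bot
  p_inf := ρ.p_inf
  p_sup := ρ.p_sup
  p_mul_s_eq_s_mul_p A _ _ _ := ρ.p_mul_s_eq_s_mul_p A _
  sStar_mul_p_eq_p_mul_sStar A _ _ _ := ρ.sStar_mul_p_eq_p_mul_sStar A _
  sStar_mul_s _ _ := ρ.sStar_mul_s _ _
  sStar_mul_s_of_ne h _ _ _ _ := ρ.sStar_mul_s_of_ne h _ _
  s_mul_p _ C := ρ.s_mul_p _ C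
  p_mul_sStar _ C := ρ.p_mul_sStar _ C
  p_eq_sum hA := ρ.p_eq_sum (D := D.full) hA

section LocalUnits

/-- The commuting idempotents `p_A` and `s_{α,A} s*_{α,A}`. -/
def localUnits : Set S :=
  Set.range ρ.p ∪ {e | ∃ α A hA, ρ.s α A hA * ρ.sStar α A hA = e}

theorem p_mem_localUnits (A : B) : ρ.p A ∈ ρ.localUnits := .inl ⟨A, rfl⟩

theorem s_mul_sStar_mem_localUnits {α : L} {A : B} (hA : A ∈ D.I α) :
    ρ.s α A hA * ρ.sStar α A hA ∈ ρ.localUnits := .inr ⟨α, A, hA, rfl⟩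

theorem commute_p_s_mul_sStar (A : B) {α : L} {C : B} (hC : C ∈ D.I α) :
    Commute (ρ.p A) (ρ.s α C hC * ρ.sStar α C hC) := by
  rw [commute_iff_eq, ← mul_assoc, p_mul_s_eq_s_mul_p, mul_assoc, mul_assoc,
    sStar_mul_p_eq_p_mul_sStar]

theorem s_mul_sStar_mul_s_mul_sStar {α : L} {A C : B} (hA : A ∈ D.I α) (hC : C ∈ D.I α) :
    ρ.s α A hA * ρ.sStar α A hA * (ρ.s α C hC * ρ.sStar α C hC) =
      ρ.s α (A ⊓ C) (inf_mem_I hA C) * ρ.sStar α (A ⊓ C) (inf_mem_I hA C) := by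
  rw [mul_assoc, ← mul_assoc (ρ.sStar α A hA), sStar_mul_s, ← p_mul_p_self, mul_assoc,
    p_mul_sStar, ← mul_assoc, s_mul_p]
  simp only [inf_left_idem, inf_left_comm C, inf_idem]

theorem s_mul_sStar_mul_s_mul_sStar_of_ne {α β : L} (h : α ≠ β) {A C : B} (hA : A ∈ D.I α)
    (hC : C ∈ D.I β) : ρ.s α A hA * ρ.sStar α A hA * (ρ.s β C hC * ρ.sStar β C hC) = 0 := by
  rw [mul_assoc, ← mul_assoc (ρ.sStar α A hA), sStar_mul_s_of_ne _ h, zero_mul, mul_zero]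

theorem commute_of_mem_localUnits {e f : S} (he : e ∈ ρ.localUnits) (hf : f ∈ ρ.localUnits) :
    Commute e f := by
  rcases he with ⟨A, rfl⟩ | ⟨α, A, hA, rfl⟩ <;> rcases hf with ⟨C, rfl⟩ | ⟨β, C, hC, rfl⟩
  · rw [commute_iff_eq, p_mul_p, p_mul_p, inf_comm]
  · exact ρ.commute_p_s_mul_sStar A hC
  · exact (ρ.commute_p_s_mul_sStar C hA).symm
  · rw [commute_iff_eq]
    obtain rfl | h := eq_or_ne α β
    · simp only [s_mul_sStar_mul_s_mul_sStar, inf_comm]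
    · rw [s_mul_sStar_mul_s_mul_sStar_of_ne _ h, s_mul_sStar_mul_s_mul_sStar_of_ne _ h.symm]

end LocalUnits

section Lift

variable {R : Type u} [CommRing R] [Module R S] [IsScalarTower R S S] [SMulCommClass R S S]

/-- The images of the generating symbols under a representation. -/
def onGen : D.Gen → S
  | .p A => ρ.p A
  | .s α A hA => ρ.s α A hA
  | .sStar α A hA => ρ.sStar α A hA

variable (R) in
/-- The extension of a representation to the free algebra. -/
noncomputable def freeLift : Free R D →ₙₐ[R] S :=
  MonoidAlgebra.liftMagma R (FreeSemigroup.lift ρ.onGen)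

@[simp]
theorem freeLift_gen (g : D.Gen) : ρ.freeLift R (gen R D g) = ρ.onGen g := by
  simp [freeLift, gen]

theorem freeLift_eq_of_rel {a b : Free R D} (h : Rel R D a b) :
    ρ.freeLift R a = ρ.freeLift R b := by
  cases h with
  | p_bot => simpa [onGen] using ρ.p_bot
  | p_inf A C => simpa [onGen] using ρ.p_inf A C
  | p_sup A C => simpa [onGen] using ρ.p_sup A C
  | p_s A α C hC => simpa [onGen] using ρ.p_mul_s_eq_s_mul_p A hC
  | sStar_p A α C hC => simpa [onGen] using ρ.sStar_mul_p_eq_p_mul_sStar A hC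
  | sStar_s α A C hA hC => simpa [onGen] using ρ.sStar_mul_s hA hC
  | sStar_s_ne α β h A C hA hC => simpa [onGen] using ρ.sStar_mul_s_of_ne h hA hC
  | s_p α A C hA => simpa [onGen] using ρ.s_mul_p hA C
  | p_sStar α A C hA => simpa [onGen] using ρ.p_mul_sStar hA C
  | p_reg A hA => simpa [onGen] using ρ.p_eq_sum hA

theorem freeLift_eq_of_con {x y : Free R D} (h : con R D x y) :
    ρ.freeLift R x = ρ.freeLift R y := by
  suffices con R D ≤ (⊥ : RingCon S).comap (ρ.freeLift R) from this h
  refine RingCon.ringConGen_le.2 ?_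
  rintro _ _ ⟨r, a, b, hab, rfl, rfl⟩
  change ρ.freeLift R (r • a) = ρ.freeLift R (r • b)
  rw [map_smul, map_smul, ρ.freeLift_eq_of_rel hab]

variable (R) in
/-- The homomorphism from the algebra of `D` determined by a representation of `D`. -/
noncomputable def lift : Alg R D →ₙₐ[R] S where
  toFun := Quotient.lift (s := (con R D).toSetoid) (ρ.freeLift R) fun _ _ => ρ.freeLift_eq_of_con
  map_smul' r x := by
    obtain ⟨a, rfl⟩ := toAlg_surjective R D x
    exact map_smul (ρ.freeLift R) r a
  map_zero' := map_zero (ρ.freeLift R)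
  map_add' x y := by
    obtain ⟨a, rfl⟩ := toAlg_surjective R D x
    obtain ⟨b, rfl⟩ := toAlg_surjective R D y
    exact map_add (ρ.freeLift R) a b
  map_mul' x y := by
    obtain ⟨a, rfl⟩ := toAlg_surjective R D x
    obtain ⟨b, rfl⟩ := toAlg_surjective R D y
    exact map_mul (ρ.freeLift R) a b

end Lift

end CuntzKriegerRep

section Universal

variable {R : Type u} [CommRing R]

theorem toAlg_eq_of_rel {x y : Free R D} (h : Rel R D x y) : toAlg R D x = toAlg R D y :=
  (RingCon.eq _).2 (RingConGen.Rel.of _ _ ⟨1, x, y, h, (one_smul _ _).symm, (one_smul _ _).symm⟩)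

/-- The universal representation of `D`, in the algebra of `D`. -/
noncomputable def univRep (R : Type u) [CommRing R] (D : GenBoolDynSys B L) :
    D.CuntzKriegerRep (Alg R D) where
  p A := toAlg R D (gen R D (.p A))
  s α A hA := toAlg R D (gen R D (.s α A hA))
  sStar α A hA := toAlg R D (gen R D (.sStar α A hA))
  p_bot := toAlg_eq_of_rel .p_bot
  p_inf A C := toAlg_eq_of_rel (.p_inf A C)
  p_sup A C := toAlg_eq_of_rel (.p_sup A C)
  p_mul_s_eq_s_mul_p A _ _ hC := toAlg_eq_of_rel (.p_s A _ _ hC)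
  sStar_mul_p_eq_p_mul_sStar A _ _ hC := toAlg_eq_of_rel (.sStar_p A _ _ hC)
  sStar_mul_s hA hC := toAlg_eq_of_rel (.sStar_s _ _ _ hA hC)
  sStar_mul_s_of_ne h _ _ hA hC := toAlg_eq_of_rel (.sStar_s_ne _ _ h _ _ hA hC)
  s_mul_p hA C := toAlg_eq_of_rel (.s_p _ _ C hA)
  p_mul_sStar hA C := toAlg_eq_of_rel (.p_sStar _ _ C hA)
  p_eq_sum hA := (toAlg_eq_of_rel (.p_reg _ hA)).trans (map_sum (toAlgAddHom R D) _ _)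

@[elab_as_elim]
theorem Alg.induction {motive : Alg R D → Prop} (p : ∀ A, motive ((univRep R D).p A))
    (s : ∀ α A hA, motive ((univRep R D).s α A hA))
    (sStar : ∀ α A hA, motive ((univRep R D).sStar α A hA))
    (add : ∀ x y, motive x → motive y → motive (x + y))
    (smul : ∀ (r : R) x, motive x → motive (r • x))
    (mul : ∀ x y, motive x → motive y → motive (x * y)) (x : Alg R D) : motive x := by
  have gen_mem (g : D.Gen) : motive (toAlg R D (gen R D g)) := by
    cases g with
    | p A => exact p A
    | s α A hA => exact s α A hA
    | sStar α A hA => exact sStar α A hA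
  have word_mem (w : FreeSemigroup D.Gen) : motive (toAlg R D (MonoidAlgebra.single w 1)) := by
    induction w using FreeSemigroup.recOnMul with
    | ih1 g => exact gen_mem g
    | ih2 g w hg hw =>
      rw [← one_mul (1 : R), ← MonoidAlgebra.single_mul_single]
      exact mul _ _ hg hw
  obtain ⟨y, rfl⟩ := toAlg_surjective R D x
  induction y using MonoidAlgebra.induction_linear with
  | zero =>
    change motive 0
    simpa using smul 0 _ (p ⊥)
  | add f g hf hg => exact add _ _ hf hg
  | single w r =>
    rw [← mul_one r, ← smul_eq_mul, ← MonoidAlgebra.smul_single]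
    exact smul r _ (word_mem w)

variable {S : Type*} [NonUnitalRing S] [Module R S] [IsScalarTower R S S] [SMulCommClass R S S]
  (ρ : D.CuntzKriegerRep S)

@[simp]
theorem lift_univRep_p (A : B) : ρ.lift R ((univRep R D).p A) = ρ.p A := ρ.freeLift_gen (.p A)

@[simp]
theorem lift_univRep_s {α : L} {A : B} (hA : A ∈ D.I α) :
    ρ.lift R ((univRep R D).s α A hA) = ρ.s α A hA := ρ.freeLift_gen (.s α A hA)

@[simp]
theorem lift_univRep_sStar {α : L} {A : B} (hA : A ∈ D.I α) :
    ρ.lift R ((univRep R D).sStar α A hA) = ρ.sStar α A hA := ρ.freeLift_gen (.sStar α A hA)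

end Universal

section LocalUnits

variable {R : Type u} [CommRing R]

theorem span_localUnit_mul_eq_self :
    Submodule.span R {x : Alg R D | ∃ e ∈ (univRep R D).localUnits, e * x = x} = ⊤ := by
  refine top_le_iff.1 fun x _ => ?_
  induction x using Alg.induction with
  | p A =>
    exact Submodule.subset_span ⟨_, (univRep R D).p_mem_localUnits A,
      (univRep R D).p_mul_p_self A⟩
  | s α A hA =>
    exact Submodule.subset_span ⟨_, (univRep R D).s_mul_sStar_mem_localUnits hA, by
      rw [mul_assoc, CuntzKriegerRep.sStar_mul_s, inf_idem, CuntzKriegerRep.s_mul_p_self]⟩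
  | sStar α A hA =>
    exact Submodule.subset_span ⟨_, (univRep R D).p_mem_localUnits A,
      (univRep R D).p_mul_sStar_self hA⟩
  | add x y hx hy => exact add_mem (hx trivial) (hy trivial)
  | smul r x hx => exact Submodule.smul_mem _ r (hx trivial)
  | mul x y hx _ =>
    refine map_mem_of_mem_span (hx trivial) (LinearMap.mulRight R y) ?_
    rintro z ⟨e, he, hez⟩
    exact Submodule.subset_span ⟨e, he, by rw [LinearMap.mulRight_apply, ← mul_assoc, hez]⟩

theorem span_mul_localUnit_eq_self :
    Submodule.span R {x : Alg R D | ∃ e ∈ (univRep R D).localUnits, x * e = x} = ⊤ := by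
  refine top_le_iff.1 fun x _ => ?_
  induction x using Alg.induction with
  | p A =>
    exact Submodule.subset_span ⟨_, (univRep R D).p_mem_localUnits A,
      (univRep R D).p_mul_p_self A⟩
  | s α A hA =>
    exact Submodule.subset_span ⟨_, (univRep R D).p_mem_localUnits A,
      (univRep R D).s_mul_p_self hA⟩
  | sStar α A hA =>
    exact Submodule.subset_span ⟨_, (univRep R D).s_mul_sStar_mem_localUnits hA, by
      rw [← mul_assoc, CuntzKriegerRep.sStar_mul_s, inf_idem, CuntzKriegerRep.p_mul_sStar_self]⟩
  | add x y hx hy => exact add_mem (hx trivial) (hy trivial)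
  | smul r x hx => exact Submodule.smul_mem _ r (hx trivial)
  | mul x y _ hy =>
    refine map_mem_of_mem_span (hy trivial) (LinearMap.mulLeft R x) ?_
    rintro z ⟨e, he, hze⟩
    exact Submodule.subset_span ⟨e, he, by rw [LinearMap.mulLeft_apply, mul_assoc, hze]⟩

theorem eq_zero_of_p_mul_of_sStar_mul {x : Alg R D} (hp : ∀ A, (univRep R D).p A * x = 0)
    (hs : ∀ α A hA, (univRep R D).sStar α A hA * x = 0) : x = 0 := by
  refine eq_zero_of_mem_span_fixed (R := R) (E := LinearMap.mulLeft R '' (univRep R D).localUnits)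
    ?_ ?_ ?_
  · rintro _ ⟨e, he, rfl⟩ _ ⟨f, hf, rfl⟩
    rw [Module.End.mul_eq_comp, Module.End.mul_eq_comp, ← LinearMap.mulLeft_mul,
      ← LinearMap.mulLeft_mul, ((univRep R D).commute_of_mem_localUnits he hf).eq]
  · simp only [Set.exists_mem_image, LinearMap.mulLeft_apply, span_localUnit_mul_eq_self,
      Submodule.mem_top]
  · rintro _ ⟨_, ⟨A, rfl⟩ | ⟨α, A, hA, rfl⟩, rfl⟩
    · exact hp A
    · rw [LinearMap.mulLeft_apply, mul_assoc, hs, mul_zero]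

theorem eq_zero_of_mul_p_of_mul_s {x : Alg R D} (hp : ∀ A, x * (univRep R D).p A = 0)
    (hs : ∀ α A hA, x * (univRep R D).s α A hA = 0) : x = 0 := by
  refine eq_zero_of_mem_span_fixed (R := R) (E := LinearMap.mulRight R '' (univRep R D).localUnits)
    ?_ ?_ ?_
  · rintro _ ⟨e, he, rfl⟩ _ ⟨f, hf, rfl⟩
    rw [Module.End.mul_eq_comp, Module.End.mul_eq_comp, ← LinearMap.mulRight_mul,
      ← LinearMap.mulRight_mul, ((univRep R D).commute_of_mem_localUnits he hf).eq]
  · simp only [Set.exists_mem_image, LinearMap.mulRight_apply, span_mul_localUnit_eq_self,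
      Submodule.mem_top]
  · rintro _ ⟨_, ⟨A, rfl⟩ | ⟨α, A, hA, rfl⟩, rfl⟩
    · exact hp A
    · rw [LinearMap.mulRight_apply, ← mul_assoc, hs, zero_mul]

end LocalUnits

theorem Δ_mono {A C : B} (h : A ≤ C) : D.Δ A ⊆ D.Δ C := by
  intro α hA hC
  refine hA ?_
  rw [← inf_eq_left.2 h, D.θ_inf, hC, inf_bot_eq]

theorem mem_reg_of_le {A C : B} (hC : C ∈ D.reg) (h : A ≤ C) : A ∈ D.reg :=
  fun X hX => hC X (hX.trans h)

namespace CuntzKriegerRep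

variable {S : Type*} [NonUnitalRing S] (ρ : D.CuntzKriegerRep S)

theorem s_bot {α : L} : ρ.s α ⊥ (D.I α).bot_mem = 0 := by
  rw [← s_mul_p_self, p_bot, mul_zero]

theorem p_eq_sum_of_Δ_subset {A : B} (hA : A ∈ D.reg) {F : Finset L} (hF : D.Δ A ⊆ F) :
    ρ.p A = ∑ α ∈ F,
      ρ.s α (D.θ α A) (D.θ_mem_I α A) * ρ.sStar α (D.θ α A) (D.θ_mem_I α A) := by
  rw [ρ.p_eq_sum hA]
  refine Finset.sum_subset (fun α hα => hF (by simpa using hα)) fun α _ hα => ?_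
  have hθ : D.θ α A = ⊥ := by simpa [Δ] using hα
  simp only [hθ, s_bot, zero_mul]

theorem apply_bot_of_apply_inf {f : B → S} (hf : ∀ A C, f (A ⊓ C) = ρ.p A * f C) : f ⊥ = 0 := by
  rw [← inf_idem ⊥, hf, p_bot, zero_mul]

theorem p_mul_apply_self_of_apply_inf {f : B → S} (hf : ∀ A C, f (A ⊓ C) = ρ.p A * f C) (A : B) :
    ρ.p A * f A = f A := by
  rw [← hf, inf_idem]

theorem apply_sup_of_apply_inf {f : B → S} (hf : ∀ A C, f (A ⊓ C) = ρ.p A * f C) (A C : B) :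
    f (A ⊔ C) = f A + f C - f (A ⊓ C) := by
  rw [← ρ.p_mul_apply_self_of_apply_inf hf (A ⊔ C), p_sup, sub_mul, add_mul, ← hf, ← hf, ← hf,
    inf_sup_self, inf_eq_left.2 (le_sup_right : C ≤ A ⊔ C),
    inf_eq_left.2 (inf_le_sup : A ⊓ C ≤ A ⊔ C)]

variable {R : Type u} [CommRing R] [Module R S] [SMulCommClass R S S]

variable (R) in
/-- The module coinduced by a representation `ρ` of `D` in `S`: the pairs of families `f_A` and
`g_{α,A}` in `S`, for arbitrary `A`, which are related like `p_A q` and `s*_{α,A} q` for an element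
`q` of a module over the algebra of the full system. -/
def coinduced : Submodule R ((B → S) × (L → B → S)) where
  carrier := {v | (∀ A C, v.1 (A ⊓ C) = ρ.p A * v.1 C) ∧
    (∀ α A C, v.2 α (A ⊓ C) = ρ.p A * v.2 α C) ∧
    ∀ α A hA C, ρ.sStar α A hA * v.1 C = v.2 α (A ⊓ D.θ α C)}
  zero_mem' := by simp
  add_mem' h h' := by simp_all [mul_add]
  smul_mem' r v h := by simp_all [mul_smul_comm]

namespace coinduced

variable {ρ}

theorem fst_inf (v : ρ.coinduced R) (A C : B) : v.1.1 (A ⊓ C) = ρ.p A * v.1.1 C := v.2.1 A C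

theorem snd_inf (v : ρ.coinduced R) (α : L) (A C : B) :
    v.1.2 α (A ⊓ C) = ρ.p A * v.1.2 α C := v.2.2.1 α A C

theorem sStar_mul_fst (v : ρ.coinduced R) {α : L} {A : B} (hA : A ∈ D.I α) (C : B) :
    ρ.sStar α A hA * v.1.1 C = v.1.2 α (A ⊓ D.θ α C) := v.2.2.2 α A hA C

theorem fst_bot (v : ρ.coinduced R) : v.1.1 ⊥ = 0 := ρ.apply_bot_of_apply_inf (fst_inf v)

theorem snd_bot (v : ρ.coinduced R) (α : L) : v.1.2 α ⊥ = 0 :=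
  ρ.apply_bot_of_apply_inf (snd_inf v α)

theorem p_mul_fst_self (v : ρ.coinduced R) (A : B) : ρ.p A * v.1.1 A = v.1.1 A :=
  ρ.p_mul_apply_self_of_apply_inf (fst_inf v) A

theorem p_mul_snd_self (v : ρ.coinduced R) (α : L) (A : B) : ρ.p A * v.1.2 α A = v.1.2 α A :=
  ρ.p_mul_apply_self_of_apply_inf (snd_inf v α) A

theorem fst_sup (v : ρ.coinduced R) (A C : B) :
    v.1.1 (A ⊔ C) = v.1.1 A + v.1.1 C - v.1.1 (A ⊓ C) :=
  ρ.apply_sup_of_apply_inf (fst_inf v) A C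

theorem snd_sup (v : ρ.coinduced R) (α : L) (A C : B) :
    v.1.2 α (A ⊔ C) = v.1.2 α A + v.1.2 α C - v.1.2 α (A ⊓ C) :=
  ρ.apply_sup_of_apply_inf (snd_inf v α) A C

theorem ext {v v' : ρ.coinduced R} (h₁ : ∀ A, v.1.1 A = v'.1.1 A)
    (h₂ : ∀ α A, v.1.2 α A = v'.1.2 α A) : v = v' :=
  Subtype.ext (Prod.ext (funext h₁) (funext fun α => funext (h₂ α)))

theorem end_ext {T T' : Module.End R (ρ.coinduced R)}
    (h₁ : ∀ v A, (T v).1.1 A = (T' v).1.1 A)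
    (h₂ : ∀ v α A, (T v).1.2 α A = (T' v).1.2 α A) : T = T' :=
  LinearMap.ext fun v => ext (h₁ v) (h₂ v)

variable (ρ R) in
/-- The action of `p_C` on the coinduced module. -/
def pEnd (C : B) : Module.End R (ρ.coinduced R) where
  toFun v := ⟨(fun A => v.1.1 (A ⊓ C), fun α A => v.1.2 α (A ⊓ D.θ α C)),
    fun A A' => by simp only [inf_assoc, fst_inf v A],
    fun α A A' => by simp only [inf_assoc, snd_inf v α A],
    fun α A hA A' => by simp only [sStar_mul_fst, D.θ_inf, inf_assoc]⟩
  map_add' _ _ := rfl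
  map_smul' _ _ := rfl

open Classical in
variable (ρ R) in
/-- The action of `s_{α,Y}` on the coinduced module. Since `Y` need not be in `I_α`, the formula
for its first coordinate reads `p_A s_{α,Y} q` as `s_{α, Y ∩ θ_α(A)} (p_Y q)`. -/
noncomputable def sEnd (α : L) (Y : B) : Module.End R (ρ.coinduced R) where
  toFun v := ⟨(fun A => ρ.s α (Y ⊓ D.θ α A) (inf_θ_mem_I α Y A) * v.1.1 Y,
      fun β A => if α = β then v.1.1 (A ⊓ Y) else 0),
    fun A A' => by simp only [← mul_assoc, p_mul_s, D.θ_inf, inf_assoc, inf_comm (D.θ α A)],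
    fun β A A' => by simp only [inf_assoc, fst_inf v A, mul_ite, mul_zero],
    fun β A hA A' => by
      obtain rfl | h := eq_or_ne α β
      · simp only [if_true, ← mul_assoc, sStar_mul_s, ← fst_inf, inf_assoc, inf_comm Y,
          inf_idem]
      · simp only [if_neg h, ← mul_assoc, sStar_mul_s_of_ne _ h.symm, zero_mul]⟩
  map_add' v v' := ext (fun A => mul_add _ _ _) fun β A => by
    by_cases h : α = β <;> simp [h]
  map_smul' r v := ext (fun A => mul_smul_comm _ _ _) fun β A => by
    by_cases h : α = β <;> simp [h]

variable (ρ R) in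
/-- The action of `s*_{α,Y}` on the coinduced module. -/
def sStarEnd (α : L) (Y : B) : Module.End R (ρ.coinduced R) where
  toFun v := ⟨(fun A => v.1.2 α (A ⊓ Y),
      fun β A => ρ.sStar β (A ⊓ D.θ β Y) (inf_θ_mem_I β A Y) * v.1.2 α Y),
    fun A A' => by simp only [inf_assoc, snd_inf v α A],
    fun β A A' => by
      simp only [← mul_assoc, p_mul_sStar, inf_comm A A', inf_right_comm],
    fun β A hA A' => by
      simp only [snd_inf v α A', ← mul_assoc, sStar_mul_p]
      nth_rewrite 1 [← p_mul_snd_self v α Y]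
      simp only [← mul_assoc, sStar_mul_p]⟩
  map_add' _ _ := ext (fun _ => rfl) fun _ _ => mul_add _ _ _
  map_smul' _ _ := ext (fun _ => rfl) fun _ _ => mul_smul_comm _ _ _

@[simp]
theorem pEnd_fst (C : B) (v : ρ.coinduced R) (A : B) :
    (pEnd ρ R C v).1.1 A = v.1.1 (A ⊓ C) := rfl

@[simp]
theorem pEnd_snd (C : B) (v : ρ.coinduced R) (α : L) (A : B) :
    (pEnd ρ R C v).1.2 α A = v.1.2 α (A ⊓ D.θ α C) := rfl

@[simp]
theorem sEnd_fst (α : L) (Y : B) (v : ρ.coinduced R) (A : B) :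
    (sEnd ρ R α Y v).1.1 A = ρ.s α (Y ⊓ D.θ α A) (inf_θ_mem_I α Y A) * v.1.1 Y := rfl

@[simp]
theorem sEnd_snd (α : L) (Y : B) (v : ρ.coinduced R) (A : B) :
    (sEnd ρ R α Y v).1.2 α A = v.1.1 (A ⊓ Y) := if_pos rfl

theorem sEnd_snd_of_ne {α β : L} (h : α ≠ β) (Y : B) (v : ρ.coinduced R) (A : B) :
    (sEnd ρ R α Y v).1.2 β A = 0 := if_neg h

@[simp]
theorem sStarEnd_fst (α : L) (Y : B) (v : ρ.coinduced R) (A : B) :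
    (sStarEnd ρ R α Y v).1.1 A = v.1.2 α (A ⊓ Y) := rfl

@[simp]
theorem sStarEnd_snd (α β : L) (Y : B) (v : ρ.coinduced R) (A : B) :
    (sStarEnd ρ R α Y v).1.2 β A =
      ρ.sStar β (A ⊓ D.θ β Y) (inf_θ_mem_I β A Y) * v.1.2 α Y := rfl

theorem pEnd_bot : pEnd ρ R ⊥ = 0 :=
  end_ext (fun v A => by simp [fst_bot]) fun v α A => by simp [D.θ_bot, snd_bot]

theorem pEnd_inf (A C : B) : pEnd ρ R (A ⊓ C) = pEnd ρ R A * pEnd ρ R C :=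
  end_ext (fun v X => by simp [inf_assoc]) fun v α X => by simp [D.θ_inf, inf_assoc]

theorem pEnd_sup (A C : B) : pEnd ρ R (A ⊔ C) = pEnd ρ R A + pEnd ρ R C - pEnd ρ R (A ⊓ C) :=
  end_ext (fun v X => by simp [inf_sup_left, fst_sup, ← inf_inf_distrib_left])
    fun v α X => by simp [D.θ_sup, D.θ_inf, inf_sup_left, snd_sup, ← inf_inf_distrib_left]

theorem pEnd_mul_sEnd (A : B) (α : L) (C : B) :
    pEnd ρ R A * sEnd ρ R α C = sEnd ρ R α C * pEnd ρ R (D.θ α A) := by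
  refine end_ext (fun v X => ?_) fun v β X => ?_
  · simp only [Module.End.mul_apply, pEnd_fst, sEnd_fst, inf_comm C (D.θ α A), fst_inf,
      ← mul_assoc, s_mul_p, D.θ_inf]
    simp only [inf_assoc, inf_comm (D.θ α X)]
  · obtain rfl | h := eq_or_ne α β
    · simp [inf_right_comm]
    · simp [sEnd_snd_of_ne h]

theorem sStarEnd_mul_pEnd (A : B) (α : L) (C : B) :
    sStarEnd ρ R α C * pEnd ρ R A = pEnd ρ R (D.θ α A) * sStarEnd ρ R α C := by
  refine end_ext (fun v X => by simp [inf_right_comm]) fun v β X => ?_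
  simp only [Module.End.mul_apply, pEnd_snd, sStarEnd_snd, inf_comm C (D.θ α A), snd_inf,
    ← mul_assoc, sStar_mul_p, inf_right_comm]

theorem sStarEnd_mul_sEnd (α : L) (A C : B) :
    sStarEnd ρ R α A * sEnd ρ R α C = pEnd ρ R (A ⊓ C) :=
  end_ext (fun v X => by simp [inf_assoc])
    fun v β X => by simp [sStar_mul_fst, D.θ_inf, inf_assoc]

theorem sStarEnd_mul_sEnd_of_ne {α β : L} (h : α ≠ β) (A C : B) :
    sStarEnd ρ R α A * sEnd ρ R β C = 0 :=
  end_ext (fun v X => by simp [sEnd_snd_of_ne h.symm])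
    fun v γ X => by simp [sEnd_snd_of_ne h.symm]

theorem sEnd_mul_pEnd (α : L) (A C : B) : sEnd ρ R α A * pEnd ρ R C = sEnd ρ R α (A ⊓ C) := by
  refine end_ext (fun v X => ?_) fun v β X => ?_
  · simp only [Module.End.mul_apply, sEnd_fst, pEnd_fst]
    rw [← p_mul_fst_self v (A ⊓ C), ← mul_assoc, ← mul_assoc, s_mul_p, s_mul_p]
    simp only [inf_assoc, inf_left_comm (D.θ α X), inf_left_idem, inf_left_comm C,
      inf_comm (D.θ α X)]
  · obtain rfl | h := eq_or_ne α β
    · simp [inf_assoc]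
    · simp [sEnd_snd_of_ne h]

theorem pEnd_mul_sStarEnd (α : L) (A C : B) :
    pEnd ρ R C * sStarEnd ρ R α A = sStarEnd ρ R α (A ⊓ C) := by
  refine end_ext (fun v X => by simp [inf_assoc, inf_comm A]) fun v β X => ?_
  simp only [Module.End.mul_apply, pEnd_snd, sStarEnd_snd, inf_comm A C, snd_inf, ← mul_assoc,
    sStar_mul_p, D.θ_inf]
  simp only [inf_assoc, inf_comm (D.θ β A), inf_left_idem]

theorem pEnd_eq_sum {A : B} (hA : A ∈ D.reg) :
    pEnd ρ R A = ∑ α ∈ (D.finite_Δ hA).toFinset,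
      sEnd ρ R α (D.θ α A) * sStarEnd ρ R α (D.θ α A) := by
  refine end_ext (fun v X => ?_) fun v β X => ?_
  · have hΔ : D.Δ (X ⊓ A) ⊆ (D.finite_Δ hA).toFinset := by
      simpa using Δ_mono (inf_le_right : X ⊓ A ≤ A)
    simp only [LinearMap.sum_apply, Submodule.coe_sum, Prod.fst_sum, Finset.sum_apply,
      Module.End.mul_apply, pEnd_fst, sEnd_fst, sStarEnd_fst]
    rw [← p_mul_fst_self, ρ.p_eq_sum_of_Δ_subset (mem_reg_of_le hA inf_le_right) hΔ,
      Finset.sum_mul]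
    refine Finset.sum_congr rfl fun α _ => ?_
    simp only [mul_assoc, sStar_mul_fst, inf_idem, D.θ_inf, snd_inf]
    simp only [← mul_assoc, s_mul_p, inf_comm (D.θ α X), inf_assoc, inf_idem]
  · simp only [LinearMap.sum_apply, Submodule.coe_sum, Prod.snd_sum, Finset.sum_apply,
      Module.End.mul_apply, pEnd_snd]
    rw [Finset.sum_eq_single β]
    · simp
    · exact fun α _ h => sEnd_snd_of_ne h _ _ _
    · intro hβ
      have hθ : D.θ β A = ⊥ := by simpa [Δ] using hβ
      simp [hθ, snd_bot]

end coinduced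

open coinduced

variable (R) in
/-- The representation of the full system on the coinduced module. -/
@[simps p s sStar]
noncomputable def coinducedRep : D.full.CuntzKriegerRep (Module.End R (ρ.coinduced R)) where
  p := pEnd ρ R
  s α A _ := sEnd ρ R α A
  sStar α A _ := sStarEnd ρ R α A
  p_bot := pEnd_bot
  p_inf := pEnd_inf
  p_sup := pEnd_sup
  p_mul_s_eq_s_mul_p A _ _ _ := pEnd_mul_sEnd A _ _
  sStar_mul_p_eq_p_mul_sStar A _ _ _ := sStarEnd_mul_pEnd A _ _
  sStar_mul_s _ _ := sStarEnd_mul_sEnd _ _ _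
  sStar_mul_s_of_ne h _ _ _ _ := sStarEnd_mul_sEnd_of_ne h _ _
  s_mul_p _ C := sEnd_mul_pEnd _ _ C
  p_mul_sStar _ C := pEnd_mul_sStarEnd _ _ C
  p_eq_sum hA := pEnd_eq_sum (D := D) hA

namespace coinduced

variable {ρ}

/-- The families `v` have the values `p_A x` and, as far as these make sense in `S`, `s*_{α,A} x`.
Values of the second family at `A ∉ I_α` are not prescribed. -/
def Represents (v : ρ.coinduced R) (x : S) : Prop :=
  (∀ A, v.1.1 A = ρ.p A * x) ∧ ∀ α A hA, v.1.2 α A = ρ.sStar α A hA * x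

variable (ρ R) in
/-- The families `p_A p_C` and `s*_{α,A} p_C`, the latter extended to all `A` by the formula
`s*_{α, A ∩ θ_α(C)}`. -/
def ofSet (C : B) : ρ.coinduced R :=
  ⟨(fun A => ρ.p A * ρ.p C, fun α A => ρ.sStar α (A ⊓ D.θ α C) (inf_θ_mem_I α A C)),
    fun A A' => by simp only [p_inf, mul_assoc],
    fun α A A' => by simp only [p_mul_sStar, inf_comm A A', inf_right_comm],
    fun α A hA A' => by simp only [p_mul_p, sStar_mul_p, D.θ_inf, inf_assoc]⟩

theorem represents_ofSet (C : B) : Represents (ofSet ρ R C) (ρ.p C) :=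
  ⟨fun _ => rfl, fun _ _ hA => (ρ.sStar_mul_p hA C).symm⟩

variable {v : ρ.coinduced R} {x : S}

namespace Represents

theorem add {w : ρ.coinduced R} {y : S} (hv : Represents v x) (hw : Represents w y) :
    Represents (v + w) (x + y) :=
  ⟨fun A => (congrArg₂ (· + ·) (hv.1 A) (hw.1 A)).trans (mul_add _ _ _).symm,
    fun α A hA => (congrArg₂ (· + ·) (hv.2 α A hA) (hw.2 α A hA)).trans (mul_add _ _ _).symm⟩

theorem smul (hv : Represents v x) (r : R) : Represents (r • v) (r • x) :=
  ⟨fun A => (congrArg (r • ·) (hv.1 A)).trans (mul_smul_comm _ _ _).symm,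
    fun α A hA => (congrArg (r • ·) (hv.2 α A hA)).trans (mul_smul_comm _ _ _).symm⟩

theorem pEnd (hv : Represents v x) (C : B) : Represents (pEnd ρ R C v) (ρ.p C * x) := by
  refine ⟨fun A => ?_, fun α A hA => ?_⟩
  · rw [pEnd_fst, hv.1, p_inf, mul_assoc]
  · rw [pEnd_snd, hv.2 _ _ (inf_mem_I hA _), ← mul_assoc, sStar_mul_p]

theorem sEnd (hv : Represents v x) {β : L} {C : B} (hC : C ∈ D.I β) :
    Represents (sEnd ρ R β C v) (ρ.s β C hC * x) := by
  refine ⟨fun A => ?_, fun α A hA => ?_⟩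
  · simp only [sEnd_fst, hv.1, ← mul_assoc, s_mul_p, p_mul_s, inf_right_comm, inf_idem]
  · obtain rfl | h := eq_or_ne β α
    · rw [sEnd_snd, hv.1, ← mul_assoc, sStar_mul_s]
    · rw [sEnd_snd_of_ne h, ← mul_assoc, sStar_mul_s_of_ne _ h.symm, zero_mul]

theorem sStarEnd (hv : Represents v x) {β : L} {C : B} (hC : C ∈ D.I β) :
    Represents (sStarEnd ρ R β C v) (ρ.sStar β C hC * x) := by
  refine ⟨fun A => ?_, fun α A hA => ?_⟩
  · simp only [sStarEnd_fst, inf_comm A C, hv.2 _ _ (inf_mem_I hC A), ← mul_assoc, p_mul_sStar]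
  · rw [sStarEnd_snd, hv.2 _ _ hC, ← mul_assoc, ← ρ.sStar_mul_sStar hA hC, mul_assoc]

end Represents

end coinduced

end CuntzKriegerRep

section Injective

open CuntzKriegerRep coinduced

variable {R : Type u} [CommRing R]

/-- The homomorphism between the algebras of `D` and of the full system which maps each generating
symbol to the one with the same name. -/
noncomputable def toFull (R : Type u) [CommRing R] (D : GenBoolDynSys B L) :
    Alg R D →ₙₐ[R] Alg R D.full := (univRep R D.full).restrict.lift R

@[simp]
theorem toFull_p (A : B) : toFull R D ((univRep R D).p A) = (univRep R D.full).p A :=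
  lift_univRep_p _ A

@[simp]
theorem toFull_s {α : L} {A : B} (hA : A ∈ D.I α) :
    toFull R D ((univRep R D).s α A hA) = (univRep R D.full).s α A (mem_full_I α A) :=
  lift_univRep_s _ hA

@[simp]
theorem toFull_sStar {α : L} {A : B} (hA : A ∈ D.I α) :
    toFull R D ((univRep R D).sStar α A hA) = (univRep R D.full).sStar α A (mem_full_I α A) :=
  lift_univRep_sStar _ hA

theorem CuntzKriegerRep.coinduced.Represents.lift_toFull {v : (univRep R D).coinduced R}
    {x : Alg R D} (hv : Represents v x) (a : Alg R D) :
    Represents (((univRep R D).coinducedRep R).lift R (toFull R D a) v) (a * x) := by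
  induction a using Alg.induction generalizing v x with
  | p C => simpa using hv.pEnd C
  | s β C hC => simpa using hv.sEnd hC
  | sStar β C hC => simpa using hv.sStarEnd hC
  | add a b ha hb => simpa [add_mul] using (ha hv).add (hb hv)
  | smul r a ha => simpa [smul_mul_assoc] using (ha hv).smul r
  | mul a b ha hb => simpa [mul_assoc] using ha (hb hv)

theorem toFull_injective : Function.Injective (toFull R D) := by
  refine (injective_iff_map_eq_zero _).2 fun a ha => ?_
  have mul_eq_zero {v : (univRep R D).coinduced R} {x : Alg R D} (hv : Represents v x) :
      a * x = 0 := by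
    have h : Represents (0 : (univRep R D).coinduced R) (a * x) := by
      simpa [ha] using hv.lift_toFull a
    exact eq_zero_of_p_mul_of_sStar_mul (fun A => (h.1 A).symm) fun α A hA => (h.2 α A hA).symm
  refine eq_zero_of_mul_p_of_mul_s (fun A => mul_eq_zero (represents_ofSet A)) fun α A hA => ?_
  rw [← s_mul_p_self]
  exact mul_eq_zero ((represents_ofSet A).lift_toFull ((univRep R D).s α A hA))

end Injective

section Corner

open CuntzKriegerRep

variable {R : Type u} [CommRing R]

theorem p_mem_range_toFull (A : B) :
    (univRep R D.full).p A ∈ NonUnitalAlgHom.range (toFull R D) :=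
  ⟨(univRep R D).p A, toFull_p A⟩

theorem s_mem_range_toFull {α : L} {A : B} (hA : A ∈ D.I α) :
    (univRep R D.full).s α A (mem_full_I α A) ∈ NonUnitalAlgHom.range (toFull R D) :=
  ⟨(univRep R D).s α A hA, toFull_s hA⟩

theorem sStar_mem_range_toFull {α : L} {A : B} (hA : A ∈ D.I α) :
    (univRep R D.full).sStar α A (mem_full_I α A) ∈ NonUnitalAlgHom.range (toFull R D) :=
  ⟨(univRep R D).sStar α A hA, toFull_sStar hA⟩

/-- The elements `y` of the algebra of the full system for which all `p_A y` and all `s*_{α,A} y`,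
with `A` arbitrary, come from the algebra of `D`. They form the largest left ideal `J` with
`φ(S) J ⊆ φ(S)`, where `φ` is the homomorphism `toFull` and `S` the algebra of `D`. -/
def cornerLeftIdeal (R : Type u) [CommRing R] (D : GenBoolDynSys B L) :
    Submodule R (Alg R D.full) where
  carrier := {y | (∀ A, (univRep R D.full).p A * y ∈ NonUnitalAlgHom.range (toFull R D)) ∧
    ∀ α A hA, (univRep R D.full).sStar α A hA * y ∈ NonUnitalAlgHom.range (toFull R D)}
  zero_mem' := ⟨fun _ => by rw [mul_zero]; exact zero_mem _,
    fun _ _ _ => by rw [mul_zero]; exact zero_mem _⟩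
  add_mem' h h' := ⟨fun A => by simpa [mul_add] using add_mem (h.1 A) (h'.1 A),
    fun α A hA => by simpa [mul_add] using add_mem (h.2 α A hA) (h'.2 α A hA)⟩
  smul_mem' r y h := ⟨fun A => by simpa [mul_smul_comm] using SMulMemClass.smul_mem r (h.1 A),
    fun α A hA => by simpa [mul_smul_comm] using SMulMemClass.smul_mem r (h.2 α A hA)⟩

variable {y : Alg R D.full}

theorem p_mul_mem_cornerLeftIdeal (C : B) (hy : y ∈ cornerLeftIdeal R D) :
    (univRep R D.full).p C * y ∈ cornerLeftIdeal R D := by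
  refine ⟨fun A => ?_, fun α A hA => ?_⟩
  · rw [← mul_assoc, p_mul_p]
    exact hy.1 _
  · rw [← mul_assoc, sStar_mul_p]
    exact hy.2 _ _ _

theorem s_mul_mem_cornerLeftIdeal (β : L) (C : B) (hC : C ∈ D.full.I β)
    (hy : y ∈ cornerLeftIdeal R D) :
    (univRep R D.full).s β C hC * y ∈ cornerLeftIdeal R D := by
  refine ⟨fun A => ?_, fun α A hA => ?_⟩
  · -- `p_A s_{β,C} = s_{β, C ∩ θ_β(A)}`, and `C ∩ θ_β(A)` belongs to `I_β` although `C` need not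
    rw [← mul_assoc, p_mul_s, ← s_mul_p_self, mul_assoc]
    exact mul_mem (s_mem_range_toFull (inf_θ_mem_I β C A)) (hy.1 _)
  · rw [← mul_assoc]
    obtain rfl | h := eq_or_ne α β
    · rw [sStar_mul_s]
      exact hy.1 _
    · rw [sStar_mul_s_of_ne _ h, zero_mul]
      exact zero_mem _

theorem sStar_mul_mem_cornerLeftIdeal (β : L) (C : B) (hC : C ∈ D.full.I β)
    (hy : y ∈ cornerLeftIdeal R D) :
    (univRep R D.full).sStar β C hC * y ∈ cornerLeftIdeal R D := by
  refine ⟨fun A => ?_, fun α A hA => ?_⟩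
  · rw [← mul_assoc, p_mul_sStar]
    exact hy.2 _ _ _
  · rw [← mul_assoc, sStar_mul_sStar, mul_assoc]
    exact mul_mem (sStar_mem_range_toFull (inf_θ_mem_I α A C)) (hy.2 _ _ _)

theorem mul_mem_cornerLeftIdeal (c : Alg R D.full) (hy : y ∈ cornerLeftIdeal R D) :
    c * y ∈ cornerLeftIdeal R D := by
  induction c using Alg.induction generalizing y with
  | p C => exact p_mul_mem_cornerLeftIdeal C hy
  | s β C hC => exact s_mul_mem_cornerLeftIdeal β C hC hy
  | sStar β C hC => exact sStar_mul_mem_cornerLeftIdeal β C hC hy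
  | add a b ha hb => simpa only [add_mul] using add_mem (ha hy) (hb hy)
  | smul r a ha => simpa only [smul_mul_assoc] using Submodule.smul_mem _ r (ha hy)
  | mul a b ha hb => simpa only [mul_assoc] using ha (hb hy)

theorem p_mem_cornerLeftIdeal (C : B) : (univRep R D.full).p C ∈ cornerLeftIdeal R D := by
  refine ⟨fun A => mul_mem (p_mem_range_toFull A) (p_mem_range_toFull C), fun α A hA => ?_⟩
  rw [sStar_mul_p]
  exact sStar_mem_range_toFull (inf_θ_mem_I α A C)

theorem sStar_mem_cornerLeftIdeal {β : L} {C : B} (hC : C ∈ D.I β) :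
    (univRep R D.full).sStar β C (mem_full_I β C) ∈ cornerLeftIdeal R D := by
  refine ⟨fun A => mul_mem (p_mem_range_toFull A) (sStar_mem_range_toFull hC), fun α A hA => ?_⟩
  rw [sStar_mul_sStar]
  exact mul_mem (sStar_mem_range_toFull (inf_θ_mem_I α A C)) (sStar_mem_range_toFull hC)

theorem toFull_mem_cornerLeftIdeal (a : Alg R D) : toFull R D a ∈ cornerLeftIdeal R D := by
  induction a using Alg.induction with
  | p C => simpa using p_mem_cornerLeftIdeal C
  | s β C hC =>
    rw [toFull_s, ← s_mul_p_self]
    exact mul_mem_cornerLeftIdeal _ (p_mem_cornerLeftIdeal C)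
  | sStar β C hC => simpa using sStar_mem_cornerLeftIdeal hC
  | add a b ha hb => simpa using add_mem ha hb
  | smul r a ha => simpa using Submodule.smul_mem _ r ha
  | mul a b _ hb => simpa using mul_mem_cornerLeftIdeal (toFull R D a) hb

theorem toFull_mul_mem_range (a : Alg R D) (hy : y ∈ cornerLeftIdeal R D) :
    toFull R D a * y ∈ NonUnitalAlgHom.range (toFull R D) := by
  induction a using Alg.induction generalizing y with
  | p A => simpa using hy.1 A
  | s α A hA =>
    rw [toFull_s, ← s_mul_p_self, mul_assoc]
    exact mul_mem (s_mem_range_toFull hA) (hy.1 A)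
  | sStar α A hA => simpa using hy.2 α A (mem_full_I α A)
  | add a b ha hb => simpa only [map_add, add_mul] using add_mem (ha hy) (hb hy)
  | smul r a ha => simpa only [map_smul, smul_mul_assoc] using SMulMemClass.smul_mem r (ha hy)
  | mul a b ha _ =>
    simpa only [map_mul, mul_assoc] using ha (mul_mem_cornerLeftIdeal (toFull R D b) hy)

theorem span_mul_eq_top : Submodule.span R {x : Alg R D | ∃ a b, a * b = x} = ⊤ := by
  refine top_le_iff.1 (span_localUnit_mul_eq_self.ge.trans (Submodule.span_mono ?_))
  rintro x ⟨e, -, he⟩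
  exact ⟨e, x, he⟩

theorem span_mul_toFull_mul_eq_top :
    Submodule.span R {x : Alg R D.full | ∃ c a d, c * toFull R D a * d = x} = ⊤ := by
  refine top_le_iff.1 (span_localUnit_mul_eq_self.ge.trans (Submodule.span_mono ?_))
  rintro x ⟨_, ⟨A, rfl⟩ | ⟨α, A, hA, rfl⟩, hx⟩
  · exact ⟨_, (univRep R D).p A, x, by rw [toFull_p, p_mul_p_self, hx]⟩
  · exact ⟨(univRep R D.full).s α A hA, (univRep R D).p A, (univRep R D.full).sStar α A hA * x, by
      rw [toFull_p, s_mul_p_self, ← mul_assoc, hx]⟩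

theorem isFullCorner_toFull (R : Type u) [CommRing R] (D : GenBoolDynSys B L) :
    IsFullCorner (toFull R D) where
  injective := toFull_injective
  mul_mul_mem_range a c b := by
    rw [mul_assoc]
    exact toFull_mul_mem_range a (mul_mem_cornerLeftIdeal c (toFull_mem_cornerLeftIdeal b))
  span_mul := span_mul_eq_top
  span_mul_mul := span_mul_toFull_mul_eq_top

end Corner

end GenBoolDynSys

theorem mainTheorem8 {R : Type u} [CommRing R] {B : Type v} {L : Type w}
    [GeneralizedBooleanAlgebra B] (D : GenBoolDynSys B L) :
    MoritaEquivalent R (GenBoolDynSys.Alg R D) (GenBoolDynSys.Alg R D.full) :=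
  ⟨rangeMul (GenBoolDynSys.toFull R D), mulRange (GenBoolDynSys.toFull R D), inferInstance,
    inferInstance, inferInstance, inferInstance,
    ⟨(GenBoolDynSys.isFullCorner_toFull R D).moritaContext⟩⟩
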